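/- Let $(\mathcal{E},\circ)$ be a finite-dimensional Euclidean Jordan algebra with unit element $e$: a finite-dimensional real inner product space with a commutative bilinear product satisfying $y\circ(y^2\circ z)=y^2\circ(y\circ z)$ (where $y^2=y\circ y$), $\langle y\circ z,w\rangle=\langle y,z\circ w\rangle$ and $y\circ e=y$ for all $y,z,w\in\mathcal{E}$. Let $\mathcal{K}=\{y\circ y\mid y\in\mathcal{E}\}$ be its cone of squares and $r$ its rank, i.e. the number of elements of any Jordan frame (a family of primitive idempotents $c_1,\dots,c_r$ with $c_i\circ c_j=0$ for $i\ne j$ and $c_1+\cdots+c_r=e$, where an idempotent is primitive if it is nonzero and is not the sum of two nonzero idempotents whose product is zero). Every $z\in\mathcal{E}$ can be written as $z=\sum_{i=1}^r\sigma_ic_i$ with $\sigma_i\in\mathbb{R}$ and a Jordan frame $c_1,\dots,c_r$; $\operatorname{rank} z$ denotes the number of nonzero $\sigma_i$. Let $f:\mathbb{R}^n\to\mathbb{R}$, $h:\mathbb{R}^n\to\mathbb{R}^m$ and $g:\mathbb{R}^n\to\mathcal{E}$ be twice continuously differentiable, and consider $$\text{(P1)}\quad \min_{x} f(x)\ \text{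 s.t. } h(x)=0,\ g(x)\in\mathcal{K},\qquad\qquad \text{(P2)}\quad \min_{x,y} f(x)\ \text{ s.t. } h(x)=0,\ g(x)-y\circ y=0,$$ with $x\in\mathbb{R}^n$, $y\in\mathcal{E}$. Let $$\mathcal{L}(x,y,\mu,\lambda)=f(x)-\langle h(x),\mu\rangle-\langle g(x)-y\circ y,\lambda\rangle .$$ A point $(x,y,\mu,\lambda)\in\mathbb{R}^n\times\mathcal{E}\times\mathbb{R}^m\times\mathcal{E}$ is a KKT quadruple of (P2) if $\nabla_{(x,y)}\mathcal{L}(x,y,\mu,\lambda)=0$, $h(x)=0$ and $g(x)-y\circ y=0$. A point $(x,\mu,\lambda)$ is a KKT triple of (P1) if $$\nabla f(x)-Jh(x)^*\mu-Jg(x)^*\lambda=0,\quad \lambda\in\mathcal{K},\quad g(x)\in\mathcal{K},\quad \lambda\circ g(x)=0,\quad h(x)=0,$$ and it satisfies strict complementarity if $\operatorname{rank} g(x)+\operatorname{rank}\lambda=r$. Let $(x,y,\mu,\lambda)$ be a KKT quadruple of (P2). (i) If $y\circ\lambda=0$ and $\langle w\circ w,\lambda\rangle>0$ for every nonzero $w\in\mathcal{E}$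 with $y\circ w=0$, then $(x,\mu,\lambda)$ is a KKT triple of (P1) satisfying strict complementarity. (ii) If SOSC-NLP holds at $(x,y,\mu,\lambda)$, that is, $\langle\nabla^2_{(x,y)}\mathcal{L}(x,y,\mu,\lambda)(v,w),(v,w)\rangle>0$ for every nonzero $(v,w)\in\mathbb{R}^n\times\mathcal{E}$ with $Jg(x)v-2\,y\circ w=0$ and $Jh(x)v=0$, then $(x,\mu,\lambda)$ is a KKT triple of (P1) satisfying strict complementarity. -/

import Mathlib

namespace NSCP

/-- A Euclidean Jordan algebra (with unit element `e`): a real inner product space with a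
commutative bilinear product that satisfies the Jordan identity and for which multiplication
operators are symmetric with respect to the inner product. Finite dimensionality is required
separately, by `[FiniteDimensional ℝ E]`. -/
class EuclideanJordanAlgebra (E : Type*) [NormedAddCommGroup E] [InnerProductSpace ℝ E] where
  /-- the Jordan product -/
  jmul : E →ₗ[ℝ] E →ₗ[ℝ] E
  /-- the unit element -/
  e : E
  jmul_comm : ∀ y z : E, jmul y z = jmul z y
  jordan : ∀ y z : E, jmul y (jmul (jmul y y) z) = jmul (jmul y y) (jmul y z)
  inner_jmul : ∀ y z w : E, inner ℝ (jmul y z) w = inner ℝ y (jmul z w)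
  jmul_e : ∀ y : E, jmul y e = y

infixl:70 " ∘ⱼ " => EuclideanJordanAlgebra.jmul

section Algebra

variable {E : Type*} [NormedAddCommGroup E] [InnerProductSpace ℝ E] [EuclideanJordanAlgebra E]

/-- The symmetric cone `K`: the cone of squares of the algebra. -/
def coneOfSquares (E : Type*) [NormedAddCommGroup E] [InnerProductSpace ℝ E]
    [EuclideanJordanAlgebra E] : Set E :=
  {z | ∃ y : E, z = y ∘ⱼ y}

/-- Idempotents of the Jordan algebra. -/
def IsIdempotent (c : E) : Prop := c ∘ⱼ c = c

/-- Primitive idempotents: nonzero idempotents that are not the sum of two nonzero idempotents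
whose product is zero. -/
def IsPrimitive (c : E) : Prop :=
  c ≠ 0 ∧ IsIdempotent c ∧
    ¬ ∃ a b : E, a ≠ 0 ∧ b ≠ 0 ∧ IsIdempotent a ∧ IsIdempotent b ∧ a ∘ⱼ b = 0 ∧ c = a + b

/-- A Jordan frame: pairwise orthogonal primitive idempotents that add up to the unit. -/
structure IsJordanFrame {r : ℕ} (c : Fin r → E) : Prop where
  primitive : ∀ i, IsPrimitive (c i)
  orthogonal : ∀ i j, i ≠ j → c i ∘ⱼ c j = 0
  sum_eq : ∑ i, c i = EuclideanJordanAlgebra.e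

/-- `y = ∑ σᵢ cᵢ` is a spectral decomposition of `y`: the `cᵢ` form a Jordan frame, and the `σᵢ`
are the eigenvalues of `y`. -/
def IsSpectralDecomposition (y : E) {r : ℕ} (c : Fin r → E) (σ : Fin r → ℝ) : Prop :=
  IsJordanFrame c ∧ y = ∑ i, σ i • c i

open Classical in
/-- The rank of `y`: the number of nonzero eigenvalues in a spectral decomposition of `y`.
In finite dimension, by the spectral theorem, the set below has exactly one element, so that
`sInf` just picks it. -/
noncomputable def rank (y : E) : ℕ :=
  sInf {k : ℕ | ∃ (r : ℕ) (c : Fin r → E) (σ : Fin r → ℝ),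
    IsSpectralDecomposition y c σ ∧ k = (Finset.univ.filter (fun i => σ i ≠ 0)).card}

/-- The rank `r` of the algebra: the number of elements of a Jordan frame. In finite dimension,
all Jordan frames have the same size, so that the set below has exactly one element. -/
noncomputable def algebraRank (E : Type*) [NormedAddCommGroup E] [InnerProductSpace ℝ E]
    [EuclideanJordanAlgebra E] : ℕ :=
  sInf {r : ℕ | ∃ c : Fin r → E, IsJordanFrame c}

/-- `y ∘ lam = 0`, and `⟨w ∘ w, lam⟩ > 0` for every nonzero `w` with `y ∘ w = 0`. -/
def MembershipCriterion (y lam : E) : Prop :=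
  y ∘ⱼ lam = 0 ∧ ∀ w : E, y ∘ⱼ w = 0 → w ≠ 0 → 0 < inner ℝ (w ∘ⱼ w) lam

end Algebra

section Problems

variable {n m : ℕ} {E : Type*} [NormedAddCommGroup E] [InnerProductSpace ℝ E]
  [FiniteDimensional ℝ E] [EuclideanJordanAlgebra E]

/-- KKT triples `(x, μ, lam)` of the nonlinear symmetric cone problem
`minimize f(x) subject to h(x) = 0, g(x) ∈ K`. -/
structure IsKKTTriple (f : EuclideanSpace ℝ (Fin n) → ℝ)
    (h : EuclideanSpace ℝ (Fin n) → EuclideanSpace ℝ (Fin m))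
    (g : EuclideanSpace ℝ (Fin n) → E)
    (x : EuclideanSpace ℝ (Fin n)) (μ : EuclideanSpace ℝ (Fin m)) (lam : E) : Prop where
  stationary : gradient f x
      - LinearMap.adjoint (fderiv ℝ h x : EuclideanSpace ℝ (Fin n) →ₗ[ℝ] EuclideanSpace ℝ (Fin m)) μ
      - LinearMap.adjoint (fderiv ℝ g x : EuclideanSpace ℝ (Fin n) →ₗ[ℝ] E) lam = 0
  dual_feasible : lam ∈ coneOfSquares E
  cone_feasible : g x ∈ coneOfSquares E
  complementary : lam ∘ⱼ g x = 0
  eq_feasible : h x = 0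

/-- Strict complementarity of `(x, lam)`: `rank g(x) + rank lam = r`. -/
def StrictComplementarity (g : EuclideanSpace ℝ (Fin n) → E)
    (x : EuclideanSpace ℝ (Fin n)) (lam : E) : Prop :=
  rank (g x) + rank lam = algebraRank E

/-- The space `ℝⁿ × E` of the variables `(x, y)` of the slack problem
`minimize f(x) subject to h(x) = 0, g(x) - y ∘ y = 0`, with the inner product
`⟨(x, y), (v, w)⟩ = ⟨x, v⟩ + ⟨y, w⟩`. -/
abbrev SlackSpace (n : ℕ) (E : Type*) : Type _ := WithLp 2 (EuclideanSpace ℝ (Fin n) × E)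

/-- The Lagrangian of the slack problem, as a function of the primal variables `p = (x, y)`. -/
noncomputable def slackLagrangian (f : EuclideanSpace ℝ (Fin n) → ℝ)
    (h : EuclideanSpace ℝ (Fin n) → EuclideanSpace ℝ (Fin m))
    (g : EuclideanSpace ℝ (Fin n) → E)
    (μ : EuclideanSpace ℝ (Fin m)) (lam : E) (p : SlackSpace n E) : ℝ :=
  f p.fst - inner ℝ (h p.fst) μ - inner ℝ (g p.fst - p.snd ∘ⱼ p.snd) lam

/-- The gradient, with respect to `(x, y)`, of a function on `ℝⁿ × E`. -/
noncomputable def slackGradient (F : SlackSpace n E → ℝ) (p : SlackSpace n E) : SlackSpace n E :=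
  haveI : CompleteSpace (SlackSpace n E) := FiniteDimensional.complete ℝ _
  gradient F p

/-- The Hessian, with respect to `(x, y)`, of a function on `ℝⁿ × E`, as a linear operator:
the derivative of the gradient. -/
noncomputable def slackHessian (F : SlackSpace n E → ℝ) (p : SlackSpace n E) :
    SlackSpace n E →L[ℝ] SlackSpace n E :=
  fderiv ℝ (slackGradient F) p

/-- KKT quadruples `(x, y, μ, lam)` of the slack problem. -/
structure IsKKTQuadruple (f : EuclideanSpace ℝ (Fin n) → ℝ)
    (h : EuclideanSpace ℝ (Fin n) → EuclideanSpace ℝ (Fin m))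
    (g : EuclideanSpace ℝ (Fin n) → E)
    (x : EuclideanSpace ℝ (Fin n)) (y : E) (μ : EuclideanSpace ℝ (Fin m)) (lam : E) : Prop where
  stationary : slackGradient (slackLagrangian f h g μ lam) (WithLp.toLp 2 (x, y)) = 0
  eq_feasible : h x = 0
  slack_feasible : g x - y ∘ⱼ y = 0

/-- The second order sufficient condition for the slack problem at `(x, y, μ, lam)`. -/
def SOSCNLP (f : EuclideanSpace ℝ (Fin n) → ℝ)
    (h : EuclideanSpace ℝ (Fin n) → EuclideanSpace ℝ (Fin m))
    (g : EuclideanSpace ℝ (Fin n) → E)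
    (x : EuclideanSpace ℝ (Fin n)) (y : E) (μ : EuclideanSpace ℝ (Fin m)) (lam : E) : Prop :=
  ∀ (v : EuclideanSpace ℝ (Fin n)) (w : E), ¬ (v = 0 ∧ w = 0) →
    fderiv ℝ g x v - (2 : ℝ) • (y ∘ⱼ w) = 0 → fderiv ℝ h x v = 0 →
    0 < inner ℝ
      (slackHessian (slackLagrangian f h g μ lam) (WithLp.toLp 2 (x, y)) (WithLp.toLp 2 (v, w)))
      (WithLp.toLp 2 (v, w))

end Problems

end NSCP

/-! Stationarity in `y` says `y ∘ⱼ lam = 0`, and the Hessian of the Lagrangian along `(0, w)` is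
`2⟨w ∘ w, lam⟩`, so (ii) reduces to (i). For (i), decompose `y = ∑ σᵢ cᵢ` and `lam = ∑ τⱼ dⱼ`. The
obstacle is that `y` may have opposite eigenvalues `s` and `-s`: its kernel then contains elements
linking the two eigenspaces, and `lam`, being in that kernel, need not be orthogonal to the `cᵢ`
with `σᵢ ≠ 0`. For `u` of this kind, `u ∘ u` is orthogonal to the whole kernel of `y`
(`inner_square_eq_zero`), in particular to `lam`. The criterion therefore forces `u = 0`, and `cᵢ ∘ⱼ
lam = 0` whenever `σᵢ ≠ 0`. Testing the criterion at `dⱼ` makes the nonzero `τⱼ` positive; testing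
it at the unit minus the supports of `y` and `lam` shows that the supports add up to the unit.
Strict complementarity then follows by comparing the two frames (`IsJordanFrame.card_eq`). -/

namespace NSCP

open EuclideanJordanAlgebra

/-! ### Jordan identities, idempotents and power associativity. -/

section Algebra

variable {E : Type*} [NormedAddCommGroup E] [InnerProductSpace ℝ E] [EuclideanJordanAlgebra E]

/-- The full linearization of the Jordan identity. -/
theorem jordan_polarized (x y z w : E) :
    x ∘ⱼ ((y ∘ⱼ z) ∘ⱼ w) + y ∘ⱼ ((z ∘ⱼ x) ∘ⱼ w) + z ∘ⱼ ((x ∘ⱼ y) ∘ⱼ w) =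
      (y ∘ⱼ z) ∘ⱼ (x ∘ⱼ w) + (z ∘ⱼ x) ∘ⱼ (y ∘ⱼ w) + (x ∘ⱼ y) ∘ⱼ (z ∘ⱼ w) := by
  have h1 := jordan (x + y + z) w
  have h2 := jordan (x + y) w
  have h3 := jordan (y + z) w
  have h4 := jordan (x + z) w
  have h5 := jordan x w
  have h6 := jordan y w
  have h7 := jordan z w
  simp only [map_add, LinearMap.add_apply, jmul_comm y x, jmul_comm z x, jmul_comm z y]
    at h1 h2 h3 h4 h5 h6 h7 ⊢
  -- Inclusion-exclusion isolates the trilinear part of the cubic identity, in which each term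
  -- occurs twice.
  linear_combination (norm := module) (1 / 2 : ℝ) • (h1 - h2 - h3 - h4 + h5 + h6 + h7)

/-- The multiplication operator of a triple product `(a ∘ b) ∘ c`. -/
theorem jmul_triple (a b c v : E) :
    ((a ∘ⱼ b) ∘ⱼ c) ∘ⱼ v = (a ∘ⱼ c) ∘ⱼ (b ∘ⱼ v) + (b ∘ⱼ c) ∘ⱼ (a ∘ⱼ v) + (a ∘ⱼ b) ∘ⱼ (c ∘ⱼ v)
      - a ∘ⱼ (c ∘ⱼ (b ∘ⱼ v)) - b ∘ⱼ (c ∘ⱼ (a ∘ⱼ v)) := by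
  have h := jordan_polarized a b v c
  rw [jmul_comm v ((a ∘ⱼ b) ∘ⱼ c), jmul_comm v a, jmul_comm (b ∘ⱼ v) c, jmul_comm (a ∘ⱼ v) c,
    jmul_comm (b ∘ⱼ v) (a ∘ⱼ c), jmul_comm (a ∘ⱼ v) (b ∘ⱼ c), jmul_comm v c] at h
  linear_combination (norm := module) h

theorem inner_jmul_left (y z w : E) : inner ℝ (y ∘ⱼ z) w = inner ℝ z (y ∘ⱼ w) := by
  rw [jmul_comm y z, inner_jmul]

theorem e_jmul (y : E) : (e : E) ∘ⱼ y = y := by rw [jmul_comm, jmul_e]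

theorem inner_e_left (y z : E) : inner ℝ (y ∘ⱼ z) (e : E) = inner ℝ y z := by
  rw [inner_jmul, jmul_e]

/-- The multiplication operator of an idempotent is annihilated by `2 X³ - 3 X² + X`. -/
theorem IsIdempotent.jmul_cubic {c : E} (hc : IsIdempotent c) (v : E) :
    c ∘ⱼ v = (3 : ℝ) • (c ∘ⱼ (c ∘ⱼ v)) - (2 : ℝ) • (c ∘ⱼ (c ∘ⱼ (c ∘ⱼ v))) := by
  have h := jmul_triple c c c v
  unfold IsIdempotent at hc
  rw [hc, hc] at h
  linear_combination (norm := module) h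

/-- The only possible eigenvalues of `c ∘ ·` are 0, 1/2 and 1, where `2t² - t` and `4(t - t²)` give
the projections onto the eigenspaces for 1 and 1/2. The form is `‖v₁‖² + ‖v_{1/2}‖² / 2`, whence the
constant `8 = 4² / 2`. -/
theorem IsIdempotent.inner_jmul_eq {c : E} (hc : IsIdempotent c) (v : E) :
    inner ℝ (c ∘ⱼ v) v = ‖(2 : ℝ) • (c ∘ⱼ (c ∘ⱼ v)) - c ∘ⱼ v‖ ^ 2
      + 8 * ‖c ∘ⱼ v - c ∘ⱼ (c ∘ⱼ v)‖ ^ 2 := by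
  have h1 := congrArg (fun u => inner ℝ u v) (hc.jmul_cubic v)
  have h2 := congrArg (fun u => inner ℝ u (c ∘ⱼ v)) (hc.jmul_cubic v)
  simp only [inner_sub_left, inner_smul_left, inner_jmul_left, RCLike.conj_to_real] at h1 h2
  rw [← real_inner_self_eq_norm_sq, ← real_inner_self_eq_norm_sq]
  simp only [inner_sub_left, inner_sub_right, inner_smul_left, inner_smul_right, inner_jmul_left,
    RCLike.conj_to_real]
  linarith

theorem IsIdempotent.inner_jmul_nonneg {c : E} (hc : IsIdempotent c) (v : E) :
    0 ≤ inner ℝ (c ∘ⱼ v) v := by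
  rw [hc.inner_jmul_eq]; positivity

theorem IsIdempotent.jmul_eq_zero {c : E} (hc : IsIdempotent c) {v : E}
    (h : inner ℝ (c ∘ⱼ v) v = (0 : ℝ)) : c ∘ⱼ v = 0 := by
  rw [hc.inner_jmul_eq] at h
  have h1 : ‖c ∘ⱼ v - c ∘ⱼ (c ∘ⱼ v)‖ ^ 2 = 0 := by 
    nlinarith [sq_nonneg ‖(2 : ℝ) • (c ∘ⱼ (c ∘ⱼ v)) - c ∘ⱼ v‖,
      sq_nonneg ‖c ∘ⱼ v - c ∘ⱼ (c ∘ⱼ v)‖]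
  have h2 : ‖(2 : ℝ) • (c ∘ⱼ (c ∘ⱼ v)) - c ∘ⱼ v‖ ^ 2 = 0 := by linarith
  rw [sq_eq_zero_iff, norm_eq_zero] at h1 h2
  linear_combination (norm := module) h2 + (2 : ℝ) • h1

theorem inner_square_right (c v : E) :
    inner ℝ c (v ∘ⱼ v) = inner ℝ (c ∘ⱼ v) v := by
  rw [← inner_jmul]

theorem IsIdempotent.inner_nonneg {c d : E} (hc : IsIdempotent c) (hd : IsIdempotent d) :
    0 ≤ inner ℝ c d := by
  have h := hc.inner_jmul_nonneg d
  rwa [← inner_square_right, hd] at h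

/-- Idempotents that are orthogonal for the inner product are orthogonal for the product. -/
theorem IsIdempotent.jmul_eq_zero_of_inner {c d : E} (hc : IsIdempotent c) (hd : IsIdempotent d)
    (h : inner ℝ c d = (0 : ℝ)) : c ∘ⱼ d = 0 := by
  apply hc.jmul_eq_zero
  rwa [← inner_square_right, hd]

theorem IsIdempotent.inner_eq_zero {c d : E} (hc : IsIdempotent c) (h : c ∘ⱼ d = 0) :
    inner ℝ c d = (0 : ℝ) := by
  rw [← hc, inner_jmul, h, inner_zero_right]

/-- Multiplications by orthogonal idempotents commute. -/
theorem IsIdempotent.jmul_left_comm {a b : E} (ha : IsIdempotent a) (h : a ∘ⱼ b = 0) (v : E) :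
    a ∘ⱼ (b ∘ⱼ v) = b ∘ⱼ (a ∘ⱼ v) := by
  have h1 := jordan_polarized a a b v
  rw [jmul_comm b a, h, ha] at h1
  simp only [map_zero, LinearMap.zero_apply, zero_add] at h1
  exact h1.symm

theorem IsIdempotent.compl {c : E} (hc : IsIdempotent c) : IsIdempotent ((e : E) - c) := by
  unfold IsIdempotent at *
  simp only [map_sub, LinearMap.sub_apply, hc, e_jmul, jmul_e]
  abel

theorem IsIdempotent.sub {c d : E} (hc : IsIdempotent c) (hd : IsIdempotent d) (h : c ∘ⱼ d = d) :
    IsIdempotent (c - d) := by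
  unfold IsIdempotent at *
  simp only [map_sub, LinearMap.sub_apply, hc, hd, h, jmul_comm d c]
  abel

/-- Multiplication by a power of `z`, an iterate of `z ∘ ·` on the unit, commutes with `z ∘ ·`. -/
theorem jmul_pow_comm (z : E) (n : ℕ) :
    ∀ v : E, (((jmul z) ^ n) e) ∘ⱼ (z ∘ⱼ v) = z ∘ⱼ ((((jmul z) ^ n) e) ∘ⱼ v) := by
  induction n using Nat.strong_induction_on with
  | _ n ih =>
    match n, ih with
    | 0, _ => intro v; simp [e_jmul]
    | 1, _ => intro v; simp [jmul_e]
    | n + 2, ih =>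
      intro v
      have h0 := ih n (by omega)
      have h1 := ih (n + 1) (by omega)
      have hp1 : ((jmul z) ^ (n + 1)) (e : E) = z ∘ⱼ ((jmul z) ^ n) e := by
        rw [pow_succ']; rfl
      have hp2 : ((jmul z) ^ (n + 2)) (e : E) = (z ∘ⱼ ((jmul z) ^ n) e) ∘ⱼ z := by
        rw [pow_succ', Module.End.mul_apply, hp1, jmul_comm]
      have hz : ∀ v : E, (z ∘ⱼ z) ∘ⱼ (z ∘ⱼ v) = z ∘ⱼ ((z ∘ⱼ z) ∘ⱼ v) := fun v => (jordan z v).symm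
      rw [hp1] at h1
      -- Multiplication by `zⁿ⁺²` is thus expressed through multiplications by `z`, `z²`, `zⁿ` and
      -- `zⁿ⁺¹`, each commuting with that by `z`.
      rw [hp2, jmul_triple, jmul_triple]
      simp only [jmul_comm (((jmul z) ^ n) (e : E)) z, map_add, map_sub, h0, h1, hz]

theorem jmul_pow (z : E) (m n : ℕ) :
    (((jmul z) ^ m) e) ∘ⱼ (((jmul z) ^ n) e) = ((jmul z) ^ (m + n)) (e : E) := by
  induction n with
  | zero => simp [jmul_e]
  | succ n ih =>
    rw [pow_succ', Module.End.mul_apply, jmul_pow_comm, ih, ← Module.End.mul_apply, ← pow_succ',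
      add_assoc]

open Polynomial in
/-- Power associativity: evaluation of polynomials at `z` is multiplicative. -/
theorem jmul_aeval (z : E) (p q : ℝ[X]) :
    (aeval (jmul z) p e) ∘ⱼ (aeval (jmul z) q e) = aeval (jmul z) (p * q) (e : E) := by
  induction p using Polynomial.induction_on' with
  | add p₁ p₂ h₁ h₂ => simp only [map_add, LinearMap.add_apply, add_mul, h₁, h₂]
  | monomial m a =>
    induction q using Polynomial.induction_on' with
    | add q₁ q₂ h₁ h₂ => simp only [map_add, LinearMap.add_apply, mul_add, h₁, h₂]
    | monomial n b =>
      simp only [monomial_mul_monomial, aeval_monomial, Module.End.mul_apply,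
        Module.algebraMap_end_apply, map_smul, LinearMap.smul_apply, jmul_pow, smul_smul]
      rw [mul_comm b a]

end Algebra

-- The eigenvectors of a symmetric operator span the space, and `q` kills each of them.
open Polynomial in
theorem aeval_eq_zero_of_isSymmetric {E : Type*} [NormedAddCommGroup E]
    [InnerProductSpace ℝ E] [FiniteDimensional ℝ E]
    {T : E →ₗ[ℝ] E} (hT : T.IsSymmetric)
    (q : ℝ[X]) (hq : ∀ s, Module.End.HasEigenvalue T s → q.eval s = 0) : aeval T q = 0 := by
  rw [← LinearMap.ker_eq_top, eq_top_iff]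
  have htop : (⨆ s, Module.End.eigenspace T s) = ⊤ := by
    rw [← Submodule.orthogonal_eq_bot_iff]
    exact hT.orthogonalComplement_iSup_eigenspaces_eq_bot
  rw [← htop]
  refine iSup_le fun s v hv => ?_
  rw [LinearMap.mem_ker]
  by_cases h0 : v = 0
  · simp [h0]
  · have hev : Module.End.HasEigenvector T s v := ⟨hv, h0⟩
    rw [Module.End.aeval_apply_of_hasEigenvector hev,
      hq s (Module.End.hasEigenvalue_of_hasEigenvector hev), zero_smul]

/-! ### Spectral theorem. -/

section Spectral

variable {E : Type*} [NormedAddCommGroup E] [InnerProductSpace ℝ E] [EuclideanJordanAlgebra E]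

/-- `z = ∑ σᵢ cᵢ` for pairwise orthogonal nonzero idempotents `cᵢ` that add up to the unit. -/
structure IsIdempotentResolution {ι : Type*} [Fintype ι] (z : E) (c : ι → E) (σ : ι → ℝ) :
    Prop where
  ne_zero : ∀ i, c i ≠ 0
  idem : ∀ i, IsIdempotent (c i)
  orthogonal : ∀ i j, i ≠ j → c i ∘ⱼ c j = 0
  sum_eq : ∑ i, c i = e
  eq_sum : z = ∑ i, σ i • c i

theorem linearIndependent_of_orthogonal {ι : Type*} {c : ι → E} (h0 : ∀ i, c i ≠ 0)
    (hc : ∀ i, IsIdempotent (c i)) (horth : ∀ i j, i ≠ j → c i ∘ⱼ c j = 0) :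
    LinearIndependent ℝ c :=
  linearIndependent_of_ne_zero_of_inner_eq_zero h0
    fun i j hij => (hc i).inner_eq_zero (horth i j hij)

theorem jmul_isSymmetric (z : E) : (EuclideanJordanAlgebra.jmul z).IsSymmetric :=
  fun v w => inner_jmul_left z v w

open Polynomial in
/-- Spectral theorem, with the idempotents that are polynomials in `z`. -/
theorem exists_idempotentResolution [FiniteDimensional ℝ E] (z : E) :
    ∃ (ι : Type) (_ : Fintype ι) (c : ι → E) (σ : ι → ℝ), IsIdempotentResolution z c σ := by
  classical
  set T : E →ₗ[ℝ] E := EuclideanJordanAlgebra.jmul z with hT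
  let S : Finset ℝ := (Module.End.finite_hasEigenvalue T).toFinset
  have hS : ∀ s, Module.End.HasEigenvalue T s → s ∈ S := fun s hs => by simpa [S] using hs
  let q : ℝ → ℝ[X] := fun s => Lagrange.basis S id s
  have hinj : Set.InjOn (id : ℝ → ℝ) S := Function.injective_id.injOn
  have hself : ∀ s ∈ S, (q s).eval s = 1 := fun s hs => Lagrange.eval_basis_self hinj hs
  have hne : ∀ s t, s ≠ t → t ∈ S → (q s).eval t = 0 :=
    fun s t hst ht => Lagrange.eval_basis_of_ne (v := id) hst ht
  have hvan : ∀ p₁ p₂ : ℝ[X], (∀ s ∈ S, p₁.eval s = p₂.eval s) →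
      aeval T p₁ (e : E) = aeval T p₂ (e : E) := by
    intro p₁ p₂ h
    have h0 := aeval_eq_zero_of_isSymmetric (jmul_isSymmetric z) (p₁ - p₂)
      fun s hs => by rw [eval_sub, h s (hS s hs), sub_self]
    rw [map_sub, sub_eq_zero] at h0
    rw [hT, h0]
  let c : ℝ → E := fun s => aeval T (q s) (e : E)
  have hidem : ∀ s ∈ S, IsIdempotent (c s) := by
    intro s hs
    unfold IsIdempotent
    rw [jmul_aeval]
    refine hvan _ _ fun t ht => ?_
    rw [eval_mul]
    by_cases hst : s = t
    · subst hst; rw [hself s hs]; norm_num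
    · rw [hne s t hst ht]; norm_num
  have horth : ∀ s ∈ S, ∀ t ∈ S, s ≠ t → c s ∘ⱼ c t = 0 := by
    intro s hs t ht hst
    rw [jmul_aeval]
    have := hvan (q s * q t) 0 fun u hu => by
      rw [eval_mul, eval_zero]
      by_cases hsu : s = u
      · rw [hne t u (fun h => hst (hsu.trans h.symm)) hu, mul_zero]
      · rw [hne s u hsu hu, zero_mul]
    simpa using this
  have hsum : ∀ p : ℝ[X], aeval T p (e : E) = ∑ s ∈ S, p.eval s • c s := by
    intro p
    rw [hvan p (∑ s ∈ S, C (p.eval s) * q s)]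
    · simp [c, LinearMap.sum_apply]
    · intro s hs
      rw [eval_finsetSum, Finset.sum_eq_single_of_mem s hs]
      · simp [hself s hs]
      · intro t ht hts
        simp [hne t s hts hs]
  -- `S` consists of the eigenvalues of the operator `z ∘ ·`, which include means of two eigenvalues
  -- of `z`; some `c s` may thus vanish and are discarded.
  let ι := {s : ℝ // s ∈ S.filter (fun s => c s ≠ 0)}
  have hcoe : ∀ F : ℝ → ℝ, ∑ s ∈ S, F s • c s = ∑ i : ι, F i • c i := by
    intro F
    rw [Finset.sum_coe_sort (S.filter (fun s => c s ≠ 0)) (fun s => F s • c s)]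
    refine (Finset.sum_filter_of_ne (p := fun s => c s ≠ 0) fun s _ h h0 => h ?_).symm
    rw [h0, smul_zero]
  refine ⟨ι, inferInstance, fun i => c i, fun i => i, ⟨fun i => (Finset.mem_filter.1 i.2).2,
    fun i => hidem _ (Finset.mem_filter.1 i.2).1, fun i j hij => horth _ (Finset.mem_filter.1 i.2).1
      _ (Finset.mem_filter.1 j.2).1 fun h => hij (Subtype.ext h), ?_, ?_⟩⟩
  · have h1 := hsum 1
    rw [hcoe] at h1
    simpa using h1.symm
  · have hX := hsum X
    rw [hcoe, aeval_X, hT, jmul_e] at hX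
    simpa using hX

/-- Splitting one of the idempotents of a resolution. -/
theorem IsIdempotentResolution.split {ι : Type*} [Fintype ι] [DecidableEq ι] {z : E} {c : ι → E}
    {σ : ι → ℝ} (H : IsIdempotentResolution z c σ) (i : ι) {a b : E} (ha0 : a ≠ 0) (hb0 : b ≠ 0)
    (ha : IsIdempotent a) (hb : IsIdempotent b) (hab : a ∘ⱼ b = 0) (hi : c i = a + b) :
    IsIdempotentResolution z (fun o : Option ι => o.elim b (Function.update c i a))
      (fun o : Option ι => o.elim (σ i) σ) := by
  -- `⟨a, cⱼ⟩` and `⟨b, cⱼ⟩` are nonnegative with sum `⟨cᵢ, cⱼ⟩ = 0`.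
  have hzero : ∀ j, j ≠ i → a ∘ⱼ c j = 0 ∧ b ∘ⱼ c j = 0 := by
    intro j hj
    have h0 := (H.idem i).inner_eq_zero (H.orthogonal i j hj.symm)
    rw [hi, inner_add_left] at h0
    have h1 := ha.inner_nonneg (H.idem j)
    have h2 := hb.inner_nonneg (H.idem j)
    exact ⟨ha.jmul_eq_zero_of_inner (H.idem j) (by linarith),
      hb.jmul_eq_zero_of_inner (H.idem j) (by linarith)⟩
  have hupd : ∀ j, j ≠ i → Function.update c i a j = c j := fun j hj =>
    Function.update_of_ne hj _ _
  refine ⟨?_, ?_, ?_, ?_, ?_⟩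
  · rintro (_ | j)
    · exact hb0
    · by_cases hj : j = i
      · subst hj; simpa using ha0
      · simpa [hupd j hj] using H.ne_zero j
  · rintro (_ | j)
    · exact hb
    · by_cases hj : j = i
      · subst hj; simpa using ha
      · simpa [hupd j hj] using H.idem j
  · have hbj : ∀ j, b ∘ⱼ Function.update c i a j = 0 := by
      intro j
      by_cases hj : j = i
      · subst hj; rw [Function.update_self, jmul_comm, hab]
      · rw [hupd j hj, (hzero j hj).2]
    rintro (_ | j) (_ | k) hjk
    · exact absurd rfl hjk
    · exact hbj k
    · exact (jmul_comm _ _).trans (hbj j)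
    · have hjk' : j ≠ k := fun h => hjk (congrArg some h)
      simp only [Option.elim]
      by_cases hj : j = i
      · subst hj; rw [Function.update_self, hupd k hjk'.symm, (hzero k hjk'.symm).1]
      · rw [hupd j hj]
        by_cases hk : k = i
        · subst hk; rw [Function.update_self, jmul_comm, (hzero j hj).1]
        · rw [hupd k hk, H.orthogonal j k hjk']
  · rw [Fintype.sum_option, ← H.sum_eq, ← Finset.add_sum_erase _ _ (Finset.mem_univ i),
      ← Finset.add_sum_erase _ c (Finset.mem_univ i), hi]
    simp only [Option.elim, Function.update_self]
    rw [Finset.sum_congr rfl fun j hj => hupd j (Finset.ne_of_mem_erase hj)]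
    abel
  · rw [Fintype.sum_option, H.eq_sum, ← Finset.add_sum_erase _ _ (Finset.mem_univ i)]
    simp only [Option.elim]
    rw [← Finset.add_sum_erase _ (fun j => σ j • Function.update c i a j) (Finset.mem_univ i),
      Function.update_self, Finset.sum_congr rfl fun j hj => by
        rw [← hupd j (Finset.ne_of_mem_erase hj)], hi, smul_add]
    abel

/-- Each split adds one idempotent, and orthogonal nonzero idempotents are linearly independent, so
`n` bounds the number of splits left. -/
theorem IsIdempotentResolution.exists_refinement [FiniteDimensional ℝ E] (z : E) (n : ℕ) :
    ∀ (ι : Type) [Fintype ι] (c : ι → E) (σ : ι → ℝ), IsIdempotentResolution z c σ →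
      Module.finrank ℝ E ≤ Fintype.card ι + n →
      ∃ (κ : Type) (_ : Fintype κ) (d : κ → E) (τ : κ → ℝ), IsIdempotentResolution z d τ ∧
        ∀ i, IsPrimitive (d i) := by
  classical
  induction n with
  | zero =>
    intro ι _ c σ H hcard
    by_cases hprim : ∀ i, IsPrimitive (c i)
    · exact ⟨ι, inferInstance, c, σ, H, hprim⟩
    · simp only [IsPrimitive, not_forall, not_and, not_not] at hprim
      obtain ⟨i, hi⟩ := hprim
      obtain ⟨a, b, ha0, hb0, ha, hb, hab, hsum⟩ := hi (H.ne_zero i) (H.idem i)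
      have H' := H.split i ha0 hb0 ha hb hab hsum
      have := (linearIndependent_of_orthogonal H'.ne_zero H'.idem
        H'.orthogonal).fintype_card_le_finrank
      rw [Fintype.card_option] at this
      omega
  | succ n ih =>
    intro ι _ c σ H hcard
    by_cases hprim : ∀ i, IsPrimitive (c i)
    · exact ⟨ι, inferInstance, c, σ, H, hprim⟩
    · simp only [IsPrimitive, not_forall, not_and, not_not] at hprim
      obtain ⟨i, hi⟩ := hprim
      obtain ⟨a, b, ha0, hb0, ha, hb, hab, hsum⟩ := hi (H.ne_zero i) (H.idem i)
      refine ih _ _ _ (H.split i ha0 hb0 ha hb hab hsum) ?_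
      rw [Fintype.card_option]
      omega

/-- The spectral theorem: every element has a spectral decomposition. -/
theorem exists_spectralDecomposition [FiniteDimensional ℝ E] (z : E) :
    ∃ (r : ℕ) (c : Fin r → E) (σ : Fin r → ℝ), IsSpectralDecomposition z c σ := by
  obtain ⟨ι, _, c, σ, H⟩ := exists_idempotentResolution z
  obtain ⟨κ, _, d, τ, H', hprim⟩ := IsIdempotentResolution.exists_refinement z
    (Module.finrank ℝ E) ι c σ H (by omega)
  let φ := (Fintype.equivFin κ).symm
  refine ⟨Fintype.card κ, d ∘ φ, τ ∘ φ, ⟨fun i => hprim _,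
    fun i j hij => H'.orthogonal _ _ fun h => hij (φ.injective h), ?_⟩, ?_⟩
  · rw [← H'.sum_eq]; exact φ.sum_comp d
  · rw [H'.eq_sum]; exact (φ.sum_comp fun i => τ i • d i).symm

end Spectral

/-! ### Jordan frames and invariance of rank. -/

section Rank

variable {E : Type*} [NormedAddCommGroup E] [InnerProductSpace ℝ E] [EuclideanJordanAlgebra E]

theorem IsJordanFrame.idem {r : ℕ} {c : Fin r → E} (H : IsJordanFrame c) (i : Fin r) :
    IsIdempotent (c i) := (H.primitive i).2.1

theorem IsJordanFrame.jmul_smul_sum {r : ℕ} {c : Fin r → E} (H : IsJordanFrame c) (σ : Fin r → ℝ)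
    (i : Fin r) : c i ∘ⱼ (∑ j, σ j • c j) = σ i • c i := by
  rw [map_sum, Finset.sum_eq_single_of_mem i (Finset.mem_univ i), map_smul, H.idem i]
  intro j _ hji
  rw [map_smul, H.orthogonal i j hji.symm, smul_zero]

theorem IsSpectralDecomposition.jmul_eq {r : ℕ} {c : Fin r → E} {z : E} {σ : Fin r → ℝ}
    (H : IsSpectralDecomposition z c σ) (i : Fin r) : c i ∘ⱼ z = σ i • c i := by
  rw [H.2, H.1.jmul_smul_sum]

theorem IsSpectralDecomposition.apply_eq {r : ℕ} {c : Fin r → E} {z : E} {σ : Fin r → ℝ}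
    (H : IsSpectralDecomposition z c σ) (v : E) : z ∘ⱼ v = ∑ i, σ i • (c i ∘ⱼ v) := by
  conv_lhs => rw [H.2]
  simp only [map_sum, LinearMap.sum_apply, map_smul, LinearMap.smul_apply]

theorem IsSpectralDecomposition.square {r : ℕ} {c : Fin r → E} {z : E} {σ : Fin r → ℝ}
    (H : IsSpectralDecomposition z c σ) :
    IsSpectralDecomposition (z ∘ⱼ z) c (fun i => σ i ^ 2) := by
  refine ⟨H.1, ?_⟩
  rw [H.apply_eq]
  exact Finset.sum_congr rfl fun i _ => by simp only [H.jmul_eq, smul_smul, sq]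

/-- An idempotent orthogonal to an element is orthogonal to its spectral idempotents. -/
theorem IsSpectralDecomposition.jmul_eq_zero {r : ℕ} {c : Fin r → E} {z : E} {σ : Fin r → ℝ}
    (H : IsSpectralDecomposition z c σ) {a : E} (ha : IsIdempotent a) (haz : a ∘ⱼ z = 0)
    {i : Fin r} (hi : σ i ≠ 0) : a ∘ⱼ c i = 0 := by
  -- Passing to the square makes every term of the spectral sum nonnegative.
  have h0 : inner ℝ a (z ∘ⱼ z) = (0 : ℝ) := by rw [inner_square_right, haz, inner_zero_left]
  rw [H.square.2, inner_sum] at h0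
  simp only [inner_smul_right] at h0
  have hnn : ∀ j ∈ Finset.univ, 0 ≤ σ j ^ 2 * inner ℝ a (c j) := fun j _ =>
    mul_nonneg (sq_nonneg _) (ha.inner_nonneg (H.1.idem j))
  have h1 := (Finset.sum_eq_zero_iff_of_nonneg hnn).1 h0 i (Finset.mem_univ i)
  exact ha.jmul_eq_zero_of_inner (H.1.idem i)
    ((mul_eq_zero.1 h1).resolve_left (pow_ne_zero 2 hi))

/-- The Peirce 1-space of a primitive idempotent is one-dimensional. -/
theorem IsPrimitive.exists_smul [FiniteDimensional ℝ E] {p : E} (hp : IsPrimitive p) {w : E}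
    (hw : p ∘ⱼ w = w) : ∃ t : ℝ, w = t • p := by
  obtain ⟨r, c, σ, H⟩ := exists_spectralDecomposition w
  have hpw : ((e : E) - p) ∘ⱼ w = 0 := by
    rw [map_sub, LinearMap.sub_apply, e_jmul, hw, sub_self]
  have hc : ∀ i, σ i ≠ 0 → c i = p := by
    intro i hi
    have h0 := H.jmul_eq_zero hp.2.1.compl hpw hi
    rw [map_sub, LinearMap.sub_apply, e_jmul, sub_eq_zero] at h0
    by_contra hne
    refine hp.2.2 ⟨c i, p - c i, (H.1.primitive i).1, sub_ne_zero.2 (Ne.symm hne), H.1.idem i,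
      hp.2.1.sub (H.1.idem i) h0.symm, ?_, by abel⟩
    rw [map_sub, H.1.idem i, jmul_comm, ← h0, sub_self]
  refine ⟨∑ i, σ i, ?_⟩
  rw [Finset.sum_smul]
  conv_lhs => rw [H.2]
  refine Finset.sum_congr rfl fun i _ => ?_
  by_cases hi : σ i = 0
  · simp [hi]
  · rw [hc i hi]

/-- Primitive idempotents that are not orthogonal have the same norm. -/
theorem IsPrimitive.norm_sq_eq [FiniteDimensional ℝ E] {p q : E} (hp : IsPrimitive p)
    (hq : IsPrimitive q) (hpq : inner ℝ p q ≠ (0 : ℝ)) :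
    (inner ℝ p p : ℝ) = inner ℝ q q := by
  have key : ∀ {a b : E}, IsPrimitive a → IsIdempotent b → ∃ β : ℝ,
      inner ℝ b a = β * (inner ℝ a a : ℝ) ∧
      2 * (inner ℝ (a ∘ⱼ b) (a ∘ⱼ b) : ℝ) - inner ℝ b a = β * (inner ℝ b a : ℝ) := by
    intro a b ha hb
    -- This is the component of `b` in the Peirce 1-space of `a`; it is paired with `a` and with `b`
    -- below.
    obtain ⟨β, hβ⟩ := ha.exists_smul (w := (2 : ℝ) • (a ∘ⱼ (a ∘ⱼ b)) - a ∘ⱼ b) (by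
      have h := ha.2.1.jmul_cubic b
      rw [map_sub, map_smul]
      linear_combination (norm := module) h)
    have haa : a ∘ⱼ a = a := ha.2.1
    refine ⟨β, ?_, ?_⟩
    · have h := congrArg (fun u => (inner ℝ u a : ℝ)) hβ
      simp only [inner_sub_left, inner_smul_left, inner_jmul_left, haa, RCLike.conj_to_real] at h
      linarith
    · have h := congrArg (fun u => (inner ℝ u b : ℝ)) hβ
      simp only [inner_sub_left, inner_smul_left, RCLike.conj_to_real] at h
      have h5 : inner ℝ (a ∘ⱼ b) b = (inner ℝ a b : ℝ) := by rw [← inner_square_right, hb]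
      rw [inner_jmul_left, h5] at h
      rw [real_inner_comm a b]
      exact h
  obtain ⟨β, h1, h2⟩ := key hq hp.2.1
  obtain ⟨α, h3, h4⟩ := key hp hq.2.1
  rw [jmul_comm q p] at h2
  rw [real_inner_comm p q] at h3 h4
  -- The left side of the second relation is symmetric in the two idempotents.
  have hαβ : α = β := mul_right_cancel₀ hpq (by linarith)
  subst hαβ
  have hα : α ≠ 0 := fun h => hpq (by rw [h1, h, zero_mul])
  exact mul_left_cancel₀ hα (h3.symm.trans h1)

/-- Both `⟨p, e⟩` and `⟨p, p⟩` are the same number. These unit row sums drive the double counting in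
`IsJordanFrame.card_eq`. -/
theorem IsJordanFrame.sum_inner_div {l : ℕ} {d : Fin l → E} (Hd : IsJordanFrame d) {p : E}
    (hp : IsPrimitive p) : ∑ j, inner ℝ p (d j) / (inner ℝ p p : ℝ) = 1 := by
  rw [← Finset.sum_div, ← inner_sum, Hd.sum_eq, ← inner_e_left p p, hp.2.1, div_self]
  rw [← hp.2.1, inner_e_left, real_inner_self_eq_norm_sq]
  exact pow_ne_zero 2 (norm_ne_zero_iff.2 hp.1)

/-- Two subfamilies of Jordan frames have the same size if each is orthogonal to the complement of
the other. -/
theorem IsJordanFrame.card_eq [FiniteDimensional ℝ E] {k l : ℕ} {c : Fin k → E} {d : Fin l → E}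
    (Hc : IsJordanFrame c) (Hd : IsJordanFrame d) (I : Finset (Fin k)) (J : Finset (Fin l))
    (h1 : ∀ i ∈ I, ∀ j ∉ J, inner ℝ (c i) (d j) = (0 : ℝ))
    (h2 : ∀ i ∉ I, ∀ j ∈ J, inner ℝ (c i) (d j) = (0 : ℝ)) : I.card = J.card := by
  have hI : ∑ i ∈ I, ∑ j ∈ J, inner ℝ (c i) (d j) / (inner ℝ (c i) (c i) : ℝ) = I.card := by
    rw [Finset.card_eq_sum_ones, Nat.cast_sum]
    refine Finset.sum_congr rfl fun i hi => ?_
    rw [Nat.cast_one, ← Hd.sum_inner_div (Hc.primitive i)]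
    exact Finset.sum_subset (Finset.subset_univ _) fun j _ hj => by rw [h1 i hi j hj, zero_div]
  have hJ : ∑ j ∈ J, ∑ i ∈ I, inner ℝ (d j) (c i) / (inner ℝ (d j) (d j) : ℝ) = J.card := by
    rw [Finset.card_eq_sum_ones, Nat.cast_sum]
    refine Finset.sum_congr rfl fun j hj => ?_
    rw [Nat.cast_one, ← Hc.sum_inner_div (Hd.primitive j)]
    exact Finset.sum_subset (Finset.subset_univ _) fun i _ hi => by
      rw [real_inner_comm, h2 i hi j hj, zero_div]
  -- The two double sums agree termwise: where `⟨cᵢ, dⱼ⟩ ≠ 0`, the normalizing denominators are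
  -- equal.
  have : (I.card : ℝ) = J.card := by
    rw [← hI, ← hJ, Finset.sum_comm]
    refine Finset.sum_congr rfl fun j _ => Finset.sum_congr rfl fun i _ => ?_
    rw [real_inner_comm (c i) (d j)]
    by_cases h0 : inner ℝ (c i) (d j) = (0 : ℝ)
    · simp [h0]
    · rw [(Hc.primitive i).norm_sq_eq (Hd.primitive j) h0]
  exact_mod_cast this

theorem algebraRank_eq [FiniteDimensional ℝ E] {r : ℕ} {c : Fin r → E} (H : IsJordanFrame c) :
    algebraRank E = r := by
  have hset : {r : ℕ | ∃ c : Fin r → E, IsJordanFrame c} = {r} := by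
    ext k
    refine ⟨?_, ?_⟩
    · rintro ⟨d, Hd⟩
      have := Hd.card_eq H Finset.univ Finset.univ (by simp) (by simp)
      simpa using this
    · rintro rfl
      exact ⟨c, H⟩
  rw [algebraRank, hset, csInf_singleton]

-- Idempotents with nonzero eigenvalue in one decomposition are orthogonal to those with eigenvalue
-- zero in another, so `IsJordanFrame.card_eq` applies.
open Classical in
theorem IsSpectralDecomposition.rank_eq [FiniteDimensional ℝ E] {z : E} {r : ℕ} {c : Fin r → E}
    {σ : Fin r → ℝ} (H : IsSpectralDecomposition z c σ) :
    rank z = (Finset.univ.filter (fun i => σ i ≠ 0)).card := by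
  have horth : ∀ {k l : ℕ} {a : Fin k → E} {b : Fin l → E} {α : Fin k → ℝ} {β : Fin l → ℝ},
      IsSpectralDecomposition z a α → IsSpectralDecomposition z b β → ∀ i, α i ≠ 0 →
      ∀ j, β j = 0 → inner ℝ (a i) (b j) = (0 : ℝ) := by
    intro k l a b α β Ha Hb i hi j hj
    rw [real_inner_comm]
    refine (Hb.1.idem j).inner_eq_zero (Ha.jmul_eq_zero (Hb.1.idem j) ?_ hi)
    rw [Hb.jmul_eq, hj, zero_smul]
  have hset : {k : ℕ | ∃ (r : ℕ) (c : Fin r → E) (σ : Fin r → ℝ),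
      IsSpectralDecomposition z c σ ∧ k = (Finset.univ.filter (fun i => σ i ≠ 0)).card} =
      {(Finset.univ.filter (fun i => σ i ≠ 0)).card} := by
    ext k
    refine ⟨?_, fun h => ⟨r, c, σ, H, h⟩⟩
    rintro ⟨l, d, τ, Hd, rfl⟩
    refine Hd.1.card_eq H.1 _ _ (fun i hi j hj => ?_) (fun i hi j hj => ?_)
    · exact horth Hd H i (by simpa using hi) j (by simpa using hj)
    · rw [real_inner_comm]
      exact horth H Hd j (by simpa using hj) i (by simpa using hi)
  rw [rank, hset, csInf_singleton]

end Rank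

/-! ### From the criterion to strict complementarity. -/

section Criterion

variable {E : Type*} [NormedAddCommGroup E] [InnerProductSpace ℝ E] [EuclideanJordanAlgebra E]

/-- On the kernel of the multiplication by `y`, the form `(u, v) ↦ ⟨u ∘ u, v⟩` vanishes if `u` is an
eigenvector of `y ∘ y` for a nonzero eigenvalue. -/
theorem inner_square_eq_zero {y u v : E} {s : ℝ} (hs : s ≠ 0) (hu : y ∘ⱼ u = 0)
    (hu2 : (y ∘ⱼ y) ∘ⱼ u = s ^ 2 • u) (hv : y ∘ⱼ v = 0) : inner ℝ (u ∘ⱼ u) v = (0 : ℝ) := by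
  have hyv : y ∘ⱼ ((y ∘ⱼ y) ∘ⱼ v) = 0 := by rw [jordan, hv, map_zero]
  have hmove : s ^ 2 • (u ∘ⱼ u) = (y ∘ⱼ y) ∘ⱼ (u ∘ⱼ u) := by
    have h := jmul_triple y y u u
    simpa [hu, hu2] using h
  have hcube : ((y ∘ⱼ y) ∘ⱼ y) ∘ⱼ v = 0 := by
    rw [jmul_triple]; simp [hv]
  have hfourth : ((y ∘ⱼ y) ∘ⱼ (y ∘ⱼ y)) ∘ⱼ v = (y ∘ⱼ y) ∘ⱼ ((y ∘ⱼ y) ∘ⱼ v) := by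
    rw [jmul_triple]; simp [hv]
  -- The polynomial `t² + st` separates the opposite eigenvalues: it is `2s²` at `s` and `0` at
  -- `-s`.
  set x := y ∘ⱼ y + s • y with hx
  have hxu : x ∘ⱼ u = s ^ 2 • u := by simp [hx, hu, hu2]
  have hxv : x ∘ⱼ (x ∘ⱼ v) = (y ∘ⱼ y) ∘ⱼ ((y ∘ⱼ y) ∘ⱼ v) := by simp [hx, hv, hyv]
  have hxxv : (x ∘ⱼ x) ∘ⱼ v = (y ∘ⱼ y) ∘ⱼ ((y ∘ⱼ y) ∘ⱼ v) + s ^ 2 • ((y ∘ⱼ y) ∘ⱼ v) := by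
    simp only [hx, map_add, map_smul, LinearMap.add_apply, LinearMap.smul_apply, hfourth, hcube,
      jmul_comm y (y ∘ⱼ y), smul_zero, smul_smul, add_zero, zero_add, sq]
  -- Since `x ∘ⱼ u` is a multiple of `u`, the remaining terms of the polarized identity cancel.
  -- Pairing with `v` leaves `⟨u ∘ u, (y ∘ y) ∘ v⟩ = 0`.
  have hpol : x ∘ⱼ (x ∘ⱼ (u ∘ⱼ u)) = (x ∘ⱼ x) ∘ⱼ (u ∘ⱼ u) := by
    have h := jordan_polarized x u u x
    rw [jmul_comm u x, hxu, jmul_comm (u ∘ⱼ u) x] at h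
    simp only [map_smul, LinearMap.smul_apply, jmul_comm u x, hxu] at h
    rw [jmul_comm (u ∘ⱼ u) (x ∘ⱼ x)] at h
    linear_combination (norm := module) h
  have h1 := congrArg (fun a => (inner ℝ a v : ℝ)) hpol
  simp only [inner_jmul_left, hxv, hxxv, inner_add_right, inner_smul_right] at h1
  have h2 := congrArg (fun a => (inner ℝ a v : ℝ)) hmove
  simp only [inner_jmul_left, inner_smul_left, RCLike.conj_to_real] at h2
  have hs2 : s ^ 2 ≠ 0 := pow_ne_zero 2 hs
  have h3 : inner ℝ u (u ∘ⱼ ((y ∘ⱼ y) ∘ⱼ v)) = (0 : ℝ) :=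
    (mul_eq_zero.1 (by linarith :
      s ^ 2 * inner ℝ u (u ∘ⱼ ((y ∘ⱼ y) ∘ⱼ v)) = (0 : ℝ))).resolve_left hs2
  rw [h3] at h2
  rw [inner_jmul_left]
  exact (mul_eq_zero.1 h2).resolve_left hs2

/-- `u = cᵢ ∘ w` stays in the kernel of `y` and satisfies `(y ∘ y) ∘ u = σᵢ² u`, so `⟨u ∘ u, lam⟩ =
0` and the criterion excludes `u ≠ 0`. -/
theorem MembershipCriterion.jmul_eq_zero {y lam : E} (hcrit : MembershipCriterion y lam) {r : ℕ}
    {c : Fin r → E} {σ : Fin r → ℝ} (H : IsSpectralDecomposition y c σ) {i : Fin r} (hi : σ i ≠ 0)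
    {w : E} (hw : y ∘ⱼ w = 0) : c i ∘ⱼ w = 0 := by
  have hcomm : ∀ v, y ∘ⱼ (c i ∘ⱼ v) = c i ∘ⱼ (y ∘ⱼ v) := by
    intro v
    rw [H.apply_eq, H.apply_eq, map_sum]
    refine Finset.sum_congr rfl fun j _ => ?_
    rw [map_smul]
    by_cases hij : i = j
    · rw [hij]
    · rw [(H.1.idem i).jmul_left_comm (H.1.orthogonal i j hij)]
  have hu : y ∘ⱼ (c i ∘ⱼ w) = 0 := by rw [hcomm, hw, map_zero]
  have hyy : (y ∘ⱼ y) ∘ⱼ c i = σ i ^ 2 • c i := by rw [jmul_comm, H.square.jmul_eq]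
  have hu2 : (y ∘ⱼ y) ∘ⱼ (c i ∘ⱼ w) = σ i ^ 2 • (c i ∘ⱼ w) := by
    have h := jmul_triple y y (c i) w
    rw [hyy, hw] at h
    simpa using h.symm
  by_contra hne
  exact (hcrit.2 _ hu hne).ne' (inner_square_eq_zero hi hu hu2 hcrit.1)

/-- The sum of the spectral idempotents for the nonzero eigenvalues acts as a unit on the element. -/
theorem IsSpectralDecomposition.support {r : ℕ} {c : Fin r → E} {z : E} {σ : Fin r → ℝ}
    (H : IsSpectralDecomposition z c σ) :
    (∑ i with σ i ≠ 0, c i) ∘ⱼ z = z ∧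
      ∀ i, σ i = 0 → c i ∘ⱼ (∑ i with σ i ≠ 0, c i) = 0 := by
  refine ⟨?_, ?_⟩
  · rw [map_sum, LinearMap.sum_apply]
    conv_rhs => rw [H.2]
    rw [Finset.sum_congr rfl fun i _ => H.jmul_eq i]
    exact Finset.sum_filter_of_ne (p := fun i => σ i ≠ 0) fun i _ h h0 => h (by rw [h0, zero_smul])
  · intro i hi
    rw [map_sum]
    refine Finset.sum_eq_zero fun j hj => H.1.orthogonal i j ?_
    rintro rfl
    exact (Finset.mem_filter.1 hj).2 hi

theorem MembershipCriterion.complementarity [FiniteDimensional ℝ E] {y lam : E}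
    (hcrit : MembershipCriterion y lam) :
    lam ∈ coneOfSquares E ∧ lam ∘ⱼ (y ∘ⱼ y) = 0 ∧
      rank (y ∘ⱼ y) + rank lam = algebraRank E := by
  obtain ⟨k, c, σ, H⟩ := exists_spectralDecomposition y
  obtain ⟨l, d, τ, G⟩ := exists_spectralDecomposition lam
  have hclam : ∀ i, σ i ≠ 0 → c i ∘ⱼ lam = 0 := fun i hi => hcrit.jmul_eq_zero H hi hcrit.1
  have hcd : ∀ i, σ i ≠ 0 → ∀ j, τ j ≠ 0 → c i ∘ⱼ d j = 0 := fun i hi j hj =>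
    G.jmul_eq_zero (H.1.idem i) (hclam i hi) hj
  have hyd : ∀ j, τ j ≠ 0 → y ∘ⱼ d j = 0 := by
    intro j hj
    rw [H.apply_eq]
    refine Finset.sum_eq_zero fun i _ => ?_
    by_cases hi : σ i = 0
    · rw [hi, zero_smul]
    · rw [hcd i hi j hj, smul_zero]
  have hτ : ∀ j, 0 ≤ τ j := by
    intro j
    by_cases hj : τ j = 0
    · exact hj.ge
    have h := hcrit.2 (d j) (hyd j hj) (G.1.primitive j).1
    rw [inner_jmul, G.jmul_eq, inner_smul_right] at h
    exact (pos_of_mul_pos_left h real_inner_self_nonneg).le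
  refine ⟨⟨∑ j, √(τ j) • d j, ?_⟩, ?_, ?_⟩
  · have hsq : IsSpectralDecomposition (∑ j, √(τ j) • d j) d (fun j => √(τ j)) := ⟨G.1, rfl⟩
    rw [hsq.square.2, G.2]
    exact Finset.sum_congr rfl fun j _ => by simp only [Real.sq_sqrt (hτ j)]
  · rw [jmul_comm, H.square.apply_eq]
    refine Finset.sum_eq_zero fun i _ => ?_
    by_cases hi : σ i = 0
    · rw [hi]; simp
    · rw [hclam i hi, smul_zero]
  · obtain ⟨hqy, hqc⟩ := H.support
    obtain ⟨hslam, hsd⟩ := G.support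
    set q := ∑ i with σ i ≠ 0, c i with hqdef
    set s := ∑ j with τ j ≠ 0, d j with hsdef
    have hqs : q ∘ⱼ s = 0 := by
      rw [hqdef, hsdef]
      simp only [map_sum, LinearMap.sum_apply]
      exact Finset.sum_eq_zero fun j hj => Finset.sum_eq_zero fun i hi =>
        hcd i (Finset.mem_filter.1 hi).2 j (Finset.mem_filter.1 hj).2
    have hqlam : q ∘ⱼ lam = 0 := by
      rw [hqdef, map_sum, LinearMap.sum_apply]
      exact Finset.sum_eq_zero fun i hi => hclam i (Finset.mem_filter.1 hi).2
    have hys : y ∘ⱼ s = 0 := by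
      rw [hsdef, map_sum]
      exact Finset.sum_eq_zero fun j hj => hyd j (Finset.mem_filter.1 hj).2
    have hsum : q + s = e := by
      by_contra hne
      -- This element is annihilated by both `y` and `lam`, contradicting the criterion.
      have hw0 : (e : E) - (q + s) ≠ 0 := sub_ne_zero.2 (Ne.symm hne)
      have hyw : y ∘ⱼ ((e : E) - (q + s)) = 0 := by
        rw [map_sub, map_add, hys, jmul_e, jmul_comm, hqy, add_zero, sub_self]
      have h := hcrit.2 _ hyw hw0
      rw [inner_jmul, map_sub, map_add, LinearMap.sub_apply, LinearMap.add_apply, e_jmul, hqlam,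
        hslam, zero_add, sub_self, inner_zero_right] at h
      exact lt_irrefl _ h
    have hcd0 : ∀ i, σ i = 0 → ∀ j, τ j = 0 → inner ℝ (c i) (d j) = (0 : ℝ) := by
      intro i hi j hj
      have hcs : c i ∘ⱼ s = c i := by
        have h := congrArg (fun u => c i ∘ⱼ u) hsum
        simpa [hqc i hi, jmul_e] using h
      rw [← hcs, inner_jmul, jmul_comm, hsd j hj, inner_zero_right]
    have hry : rank (y ∘ⱼ y) = (Finset.univ.filter fun i => σ i ^ 2 ≠ 0).card := by
      rw [H.square.rank_eq]
    have hrlam : rank lam = (Finset.univ.filter fun j => τ j ≠ 0).card := by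
      rw [G.rank_eq]
    -- The nonzero eigenvalues of `y ∘ y` are matched with the zero eigenvalues of `lam`.
    have hcard := H.1.card_eq G.1 (Finset.univ.filter fun i => σ i ^ 2 ≠ 0)
      (Finset.univ.filter fun j => ¬ τ j ≠ 0)
      (fun i hi j hj => (H.1.idem i).inner_eq_zero (hcd i (by simpa using hi) j (by simpa using hj)))
      (fun i hi j hj => hcd0 i (by simpa using hi) j (by simpa using hj))
    have htot := Finset.card_filter_add_card_filter_not (s := Finset.univ) (fun j => τ j ≠ 0)
    rw [Finset.card_univ, Fintype.card_fin] at htot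
    rw [algebraRank_eq G.1, hry, hrlam]
    omega

end Criterion

/-! ### Gradient on the slack space. -/

section SlackGradient

variable {n : ℕ} {E : Type*} [NormedAddCommGroup E] [InnerProductSpace ℝ E]
  [FiniteDimensional ℝ E]

instance : CompleteSpace (SlackSpace n E) := FiniteDimensional.complete ℝ _

theorem inner_slackGradient (F : SlackSpace n E → ℝ) (p ξ : SlackSpace n E) :
    inner ℝ (slackGradient F p) ξ = fderiv ℝ F p ξ :=
  inner_gradient_left

theorem differentiable_slackGradient {F : SlackSpace n E → ℝ} (hF : ContDiff ℝ 2 F) :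
    Differentiable ℝ (slackGradient F) :=
  (InnerProductSpace.toDual ℝ (SlackSpace n E)).symm.toContinuousLinearEquiv.differentiable.comp
    ((hF.fderiv_right (m := 1) (by norm_num)).differentiable (by norm_num))

end SlackGradient

/-! ### Derivatives of the Lagrangian and KKT conditions. -/

section Lagrangian

variable {n m : ℕ} {E : Type*} [NormedAddCommGroup E] [InnerProductSpace ℝ E]
  [FiniteDimensional ℝ E] [EuclideanJordanAlgebra E]

theorem contDiff_square : ContDiff ℝ 2 (fun y : E => y ∘ⱼ y) :=
  (jmul (E := E)).toContinuousBilinearMap.isBoundedBilinearMap.contDiff.comp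
    (contDiff_id.prodMk contDiff_id)

theorem hasFDerivAt_square (y : E) : HasFDerivAt (fun y : E => y ∘ⱼ y)
    ((2 : ℝ) • (jmul (E := E)).toContinuousBilinearMap y) y := by
  have h := ((jmul (E := E)).toContinuousBilinearMap.isBoundedBilinearMap.hasFDerivAt (y, y)).comp
    (f := fun y : E => (y, y)) y ((hasFDerivAt_id y).prodMk (hasFDerivAt_id y))
  refine h.congr_fderiv ?_
  ext w
  simp [two_smul, jmul_comm w y]

variable {f : EuclideanSpace ℝ (Fin n) → ℝ}
  {h : EuclideanSpace ℝ (Fin n) → EuclideanSpace ℝ (Fin m)}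
  {g : EuclideanSpace ℝ (Fin n) → E}

theorem contDiff_slackLagrangian (hf : ContDiff ℝ 2 f) (hh : ContDiff ℝ 2 h)
    (hg : ContDiff ℝ 2 g) (μ : EuclideanSpace ℝ (Fin m)) (lam : E) :
    ContDiff ℝ 2 (slackLagrangian f h g μ lam) := by
  have hfst : ContDiff ℝ 2 (fun p : SlackSpace n E => p.fst) :=
    (WithLp.fstL 2 ℝ (EuclideanSpace ℝ (Fin n)) E).contDiff
  have hsnd : ContDiff ℝ 2 (fun p : SlackSpace n E => p.snd) :=
    (WithLp.sndL 2 ℝ (EuclideanSpace ℝ (Fin n)) E).contDiff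
  exact ((hf.comp hfst).sub ((hh.comp hfst).inner ℝ contDiff_const)).sub
    (((hg.comp hfst).sub (contDiff_square.comp hsnd)).inner ℝ contDiff_const)

theorem fderiv_slackLagrangian (hf : ContDiff ℝ 2 f) (hh : ContDiff ℝ 2 h)
    (hg : ContDiff ℝ 2 g) (μ : EuclideanSpace ℝ (Fin m)) (lam : E) (p ξ : SlackSpace n E) :
    fderiv ℝ (slackLagrangian f h g μ lam) p ξ = fderiv ℝ f p.fst ξ.fst
      - inner ℝ (fderiv ℝ h p.fst ξ.fst) μ
      - inner ℝ (fderiv ℝ g p.fst ξ.fst - (2 : ℝ) • (p.snd ∘ⱼ ξ.snd)) lam := by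
  have hfst : HasFDerivAt (fun p : SlackSpace n E => p.fst)
      (WithLp.fstL 2 ℝ (EuclideanSpace ℝ (Fin n)) E) p :=
    (WithLp.fstL 2 ℝ (EuclideanSpace ℝ (Fin n)) E).hasFDerivAt
  have hsnd : HasFDerivAt (fun p : SlackSpace n E => p.snd)
      (WithLp.sndL 2 ℝ (EuclideanSpace ℝ (Fin n)) E) p :=
    (WithLp.sndL 2 ℝ (EuclideanSpace ℝ (Fin n)) E).hasFDerivAt
  have h1 := ((hf.differentiable (by norm_num)) p.fst).hasFDerivAt.comp p hfst
  have h2 := ((hh.differentiable (by norm_num)) p.fst).hasFDerivAt.comp p hfst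
  have h3 := ((hg.differentiable (by norm_num)) p.fst).hasFDerivAt.comp p hfst
  have h4 := (hasFDerivAt_square p.snd).comp p hsnd
  have key := (h1.sub (h2.inner ℝ (hasFDerivAt_const μ p))).sub
    ((h3.sub h4).inner ℝ (hasFDerivAt_const lam p))
  have hkey : HasFDerivAt (slackLagrangian f h g μ lam) _ p := key
  rw [hkey.fderiv]
  simp

/-- The Hessian of the Lagrangian in the direction of the slack variable. -/
theorem inner_slackHessian_snd (hf : ContDiff ℝ 2 f) (hh : ContDiff ℝ 2 h)
    (hg : ContDiff ℝ 2 g) (μ : EuclideanSpace ℝ (Fin m)) (lam : E) (p : SlackSpace n E) (w : E) :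
    inner ℝ (slackHessian (slackLagrangian f h g μ lam) p (WithLp.toLp 2 (0, w)))
      (WithLp.toLp 2 (0, w)) = 2 * (inner ℝ (w ∘ⱼ w) lam : ℝ) := by
  set ξ : SlackSpace n E := WithLp.toLp 2 (0, w) with hξ
  have h1 := ((differentiable_slackGradient
    (contDiff_slackLagrangian hf hh hg μ lam)) p).hasFDerivAt.inner ℝ (hasFDerivAt_const ξ p)
  -- The gradient paired with `(0, w)` is linear in the slack variable and independent of `x`, hence
  -- its own derivative.
  let ℓ : SlackSpace n E →L[ℝ] ℝ := (2 : ℝ) • (innerSL ℝ (w ∘ⱼ lam)).comp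
    (WithLp.sndL 2 ℝ (EuclideanSpace ℝ (Fin n)) E)
  have hℓ : ∀ q : SlackSpace n E, ℓ q = 2 * (inner ℝ (q.snd ∘ⱼ w) lam : ℝ) := by
    intro q
    rw [inner_jmul, real_inner_comm]
    rfl
  have hfun : (fun q => inner ℝ (slackGradient (slackLagrangian f h g μ lam) q) ξ) = ℓ := by
    funext q
    rw [inner_slackGradient, fderiv_slackLagrangian hf hh hg, hℓ]
    simp [hξ, inner_smul_left]
  rw [hfun] at h1
  have h2 := congrArg (fun T : SlackSpace n E →L[ℝ] ℝ => T ξ) (h1.unique ℓ.hasFDerivAt)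
  simp only [hℓ] at h2
  rw [slackHessian]
  simpa [hξ] using h2

theorem IsKKTQuadruple.stationarity {x : EuclideanSpace ℝ (Fin n)} {y : E}
    {μ : EuclideanSpace ℝ (Fin m)} {lam : E} (hf : ContDiff ℝ 2 f) (hh : ContDiff ℝ 2 h)
    (hg : ContDiff ℝ 2 g) (hkkt : IsKKTQuadruple f h g x y μ lam) :
    (gradient f x
      - LinearMap.adjoint (fderiv ℝ h x : EuclideanSpace ℝ (Fin n) →ₗ[ℝ] EuclideanSpace ℝ (Fin m)) μ
      - LinearMap.adjoint (fderiv ℝ g x : EuclideanSpace ℝ (Fin n) →ₗ[ℝ] E) lam = 0) ∧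
      y ∘ⱼ lam = 0 := by
  have hzero : ∀ (v : EuclideanSpace ℝ (Fin n)) (w : E), fderiv ℝ f x v
      - inner ℝ (fderiv ℝ h x v) μ - inner ℝ (fderiv ℝ g x v - (2 : ℝ) • (y ∘ⱼ w)) lam = 0 := by
    intro v w
    have := fderiv_slackLagrangian hf hh hg μ lam (WithLp.toLp 2 (x, y)) (WithLp.toLp 2 (v, w))
    rw [← inner_slackGradient, hkkt.stationary, inner_zero_left] at this
    exact this.symm
  refine ⟨ext_inner_right ℝ fun v => ?_, ext_inner_right ℝ fun w => ?_⟩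
  · have := hzero v 0
    rw [map_zero, smul_zero, sub_zero, real_inner_comm, real_inner_comm lam] at this
    rw [inner_sub_left, inner_sub_left, inner_gradient_left, LinearMap.adjoint_inner_left,
      LinearMap.adjoint_inner_left, inner_zero_left]
    exact this
  · have := hzero 0 w
    simp only [map_zero, inner_zero_left, zero_sub, inner_neg_left, inner_smul_left, neg_neg,
      RCLike.conj_to_real, sub_zero, inner_jmul_left, mul_eq_zero, OfNat.ofNat_ne_zero,
      false_or] at this
    rw [inner_zero_left, real_inner_comm, this]

theorem IsKKTQuadruple.isKKTTriple {x : EuclideanSpace ℝ (Fin n)} {y : E}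
    {μ : EuclideanSpace ℝ (Fin m)} {lam : E} (hf : ContDiff ℝ 2 f) (hh : ContDiff ℝ 2 h)
    (hg : ContDiff ℝ 2 g) (hkkt : IsKKTQuadruple f h g x y μ lam)
    (hcrit : MembershipCriterion y lam) :
    IsKKTTriple f h g x μ lam ∧ StrictComplementarity g x lam := by
  obtain ⟨hK, hcompl, hrank⟩ := hcrit.complementarity
  have hgx : g x = y ∘ⱼ y := sub_eq_zero.1 hkkt.slack_feasible
  exact ⟨⟨(hkkt.stationarity hf hh hg).1, hK, ⟨y, hgx⟩, by rw [hgx, hcompl], hkkt.eq_feasible⟩,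
    by rw [StrictComplementarity, hgx, hrank]⟩

/-- For `y ∘ⱼ w = 0`, the direction `(0, w)` satisfies the linearized constraints. -/
theorem SOSCNLP.membershipCriterion {x : EuclideanSpace ℝ (Fin n)} {y : E}
    {μ : EuclideanSpace ℝ (Fin m)} {lam : E} (hf : ContDiff ℝ 2 f) (hh : ContDiff ℝ 2 h)
    (hg : ContDiff ℝ 2 g) (hkkt : IsKKTQuadruple f h g x y μ lam)
    (hsosc : SOSCNLP f h g x y μ lam) : MembershipCriterion y lam := by
  refine ⟨(hkkt.stationarity hf hh hg).2, fun w hyw hw => ?_⟩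
  have := hsosc 0 w (fun h => hw h.2) (by rw [hyw]; simp) (by simp)
  rw [inner_slackHessian_snd hf hh hg] at this
  linarith

end Lagrangian

end NSCP

theorem proposition4p3 {n m : ℕ} {E : Type*} [NormedAddCommGroup E] [InnerProductSpace ℝ E]
    [FiniteDimensional ℝ E] [NSCP.EuclideanJordanAlgebra E]
    (f : EuclideanSpace ℝ (Fin n) → ℝ)
    (h : EuclideanSpace ℝ (Fin n) → EuclideanSpace ℝ (Fin m))
    (g : EuclideanSpace ℝ (Fin n) → E)
    (hf : ContDiff ℝ 2 f) (hh : ContDiff ℝ 2 h) (hg : ContDiff ℝ 2 g)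
    (x : EuclideanSpace ℝ (Fin n)) (y : E) (μ : EuclideanSpace ℝ (Fin m)) (lam : E)
    (hkkt : NSCP.IsKKTQuadruple f h g x y μ lam) :
    (NSCP.MembershipCriterion y lam →
      NSCP.IsKKTTriple f h g x μ lam ∧ NSCP.StrictComplementarity g x lam) ∧
    (NSCP.SOSCNLP f h g x y μ lam →
      NSCP.IsKKTTriple f h g x μ lam ∧ NSCP.StrictComplementarity g x lam) :=
  ⟨hkkt.isKKTTriple hf hh hg, fun hsosc =>
    hkkt.isKKTTriple hf hh hg (hsosc.membershipCriterion hf hh hg hkkt)⟩
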